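/- A real square matrix is called off-diagonal nonnegative (ODN) if all its off-diagonal entries are nonnegative. For a symmetric ODN matrix $M\in\mathbb R^{n\times n}$, $n\ge 1$, let $A_M$ be the matrix obtained from $M$ by replacing all diagonal entries by $0$, let $D_M$ be the diagonal matrix with $(D_M)_{ii}=\sum_{j\ne i}M_{ij}$, and let $L_M=D_M-A_M$. Let $\Delta_M$ and $\delta_M$ be the largest and the smallest diagonal entry of $M$, let $\rho$ denote the spectral radius, and for $\varepsilon>0$ put $$B=\varepsilon\sqrt n\,\rho(L_M)+\frac{\Delta_M-\delta_M}{2}.$$ Theorem. There is an absolute constant $C>0$ such that for every $n\ge 1$, every symmetric ODN matrix $M\in\mathbb R^{n\times n}$ with eigenvalues $\lambda_1\ge\dots\ge\lambda_n$ (counted with multiplicity) and every $0<\varepsilon\le 1/120$ there is a symmetric ODN matrix $\widehat M\in\mathbb R^{n\times n}$ with at most $Cn/\varepsilon^2$ nonzero entries whose eigenvalues $\widehat\lambda_1\ge\dots\ge\widehat\lambda_n$ (counted with multiplicity) satisfy $$|\lambda_i-\widehat\lambda_i|\le B\qquad\text{for all } i=1,\dots,n.$$ Moreover, let $1\le i\le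 n$, let $x_i$ be any eigenvector of $M$ for $\lambda_i$, let $\widehat x_i$ be any eigenvector of $\widehat M$ for $\widehat\lambda_i$, and let $\theta_i\in[0,\pi/2]$ be the angle between the lines spanned by $x_i$ and $\widehat x_i$. Then $$\sin\theta_i\le\frac{B}{\min\{|\widehat\lambda_{i-1}-\lambda_i|,\ |\lambda_i-\widehat\lambda_{i+1}|\}}$$ whenever the minimum is not $0$. Here $\widehat\lambda_0=+\infty$ and $\widehat\lambda_{n+1}=-\infty$, so that a term whose index is out of range is omitted from the minimum; for $n=1$ the minimum is $+\infty$ and the right-hand side is $0$. -/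

import Mathlib

namespace SparseODN

noncomputable section

/-- A real square matrix is off-diagonal nonnegative (ODN) if all its entries outside the diagonal
are nonnegative. -/
def IsODN {n : ℕ} (M : Matrix (Fin n) (Fin n) ℝ) : Prop :=
  ∀ i j, i ≠ j → 0 ≤ M i j

/-- The off-diagonal part `A_M` of `M`. -/
def offDiag {n : ℕ} (M : Matrix (Fin n) (Fin n) ℝ) : Matrix (Fin n) (Fin n) ℝ :=
  Matrix.of fun i j => if i = j then 0 else M i j

/-- The diagonal matrix `D_M` of the off-diagonal row sums of `M`. -/
def degMatrix {n : ℕ} (M : Matrix (Fin n) (Fin n) ℝ) : Matrix (Fin n) (Fin n) ℝ :=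
  Matrix.diagonal fun i => ∑ j ∈ Finset.univ.erase i, M i j

/-- The Laplacian `L_M = D_M - A_M`. -/
def laplacian {n : ℕ} (M : Matrix (Fin n) (Fin n) ℝ) : Matrix (Fin n) (Fin n) ℝ :=
  degMatrix M - offDiag M

/-- The spectral radius, as a real number. It is applied to symmetric matrices only, all of whose
complex eigenvalues are real, so that the real spectrum is the whole spectrum. -/
def rho {n : ℕ} (L : Matrix (Fin n) (Fin n) ℝ) : ℝ :=
  (spectralRadius ℝ L).toReal

/-- The largest diagonal entry `Δ_M`. -/
def maxDiag {n : ℕ} (M : Matrix (Fin n) (Fin n) ℝ) : ℝ := ⨆ i, M i i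

/-- The smallest diagonal entry `δ_M`. -/
def minDiag {n : ℕ} (M : Matrix (Fin n) (Fin n) ℝ) : ℝ := ⨅ i, M i i

/-- The number of nonzero entries of `M`. -/
def nnz {n : ℕ} (M : Matrix (Fin n) (Fin n) ℝ) : ℕ :=
  {p : Fin n × Fin n | M p.1 p.2 ≠ 0}.ncard

theorem isHermitian_of_isSymm {n : ℕ} {M : Matrix (Fin n) (Fin n) ℝ} (hM : M.IsSymm) :
    M.IsHermitian := by
  unfold Matrix.IsHermitian
  rw [Matrix.conjTranspose_eq_transpose_of_trivial]
  exact hM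

/-- The eigenvalues of a symmetric matrix, with multiplicity, in nonincreasing order (the index `0`
belongs to the largest one). -/
def eigval {n : ℕ} (M : Matrix (Fin n) (Fin n) ℝ) (hM : M.IsSymm) (i : Fin n) : ℝ :=
  (isHermitian_of_isSymm hM).eigenvalues₀ (Fin.cast (Fintype.card_fin n).symm i)

/-- The angle in `[0, π/2]` between the lines spanned by two nonzero vectors. -/
def lineAngle {n : ℕ} (x y : EuclideanSpace ℝ (Fin n)) : ℝ :=
  Real.arccos (|inner ℝ x y| / (‖x‖ * ‖y‖))

/-- The bound `ε √n ρ(L_M) + (Δ_M - δ_M) / 2`. -/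
def errBound {n : ℕ} (M : Matrix (Fin n) (Fin n) ℝ) (ε : ℝ) : ℝ :=
  ε * Real.sqrt n * rho (laplacian M) + (maxDiag M - minDiag M) / 2

/-- The gap `min {|μ_{i-1} - l_i|, |l_i - μ_{i+1}|}`, where a term whose index is out of range is
`∞` (that is, `μ_{-1} = +∞` and `μ_n = -∞` with indices starting at `0`). -/
def gap {n : ℕ} (l μ : Fin n → ℝ) (i : Fin n) : ENNReal :=
  min
    (if 0 < i.val then
      ENNReal.ofReal |μ ⟨i.val - 1, lt_of_le_of_lt (Nat.sub_le _ _) i.isLt⟩ - l i| else ⊤)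
    (if h : i.val + 1 < n then ENNReal.ofReal |l i - μ ⟨i.val + 1, h⟩| else ⊤)

end

end SparseODN

/-! The matrix `Mhat` comes from spectral sparsification of the regularised Laplacian `P = L_M + ρ
I`, with `ρ = ρ(L_M)`. This `P` is a sum of rank one matrices, one for each ordered pair of vertices
and one for each vertex. Reweighting `O(n / ε ^ 2)` of these terms gives `S` with `|xᵀ(S - P)x| ≤ (ε
/ 2) xᵀPx` (`exists_sparse_weights`). Put `Mhat = M + P - S`. Off the diagonal `P` equals `-A_M`, so
`M` and `P` cancel there and only `-S` remains, which is nonnegative and sparse; the diagonal costs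
at most `n` further entries. Since `xᵀPx ≤ 2ρ‖x‖²`, the error `M - Mhat = S - P` has norm at most `ε
ρ`, which is at most `B` because `√n ≥ 1` and `Δ_M ≥ δ_M`. The term `ρ I` makes `P` positive
definite, so no kernel has to be factored out.

Sparsification is the Batson–Spielman–Srivastava barrier method. Two barriers `uP` and `lP` enclose
the current sum `A`, and the potentials `tr(P(uP - A)⁻¹)` and `tr(P(A - lP)⁻¹)` stay bounded while
rank one terms are added and both barriers advance. Working relative to `P` avoids normalising it to
the identity by a square root.

The spectral claims are then perturbation theory: Weyl's inequality for the eigenvalues, and a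
residual form of Davis–Kahan for the eigenvectors. When the gap is at most `B` the angle bound is
trivial; otherwise the gap separates `λ_i` from every other eigenvalue of `Mhat` (`sin_le_div_gap`).
-/

namespace SparseODN

open Module

/-! ### Weyl and Davis–Kahan inequalities for symmetric operators. -/

section Perturbation

variable {E : Type*} [NormedAddCommGroup E] [InnerProductSpace ℝ E] {n : ℕ}

theorem inner_apply_self_eq_sum (b : OrthonormalBasis (Fin n) ℝ E) {T : E →ₗ[ℝ] E} {l : Fin n → ℝ}
    (hT : ∀ i, T (b i) = l i • b i) (x : E) :
    inner ℝ (T x) x = ∑ i, l i * inner ℝ (b i) x ^ 2 := by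
  conv_lhs => rw [← b.sum_repr' x]
  rw [map_sum, b.sum_repr' x, sum_inner]
  refine Finset.sum_congr rfl fun i _ => ?_
  rw [map_smul, hT, inner_smul_left, inner_smul_left]
  simp only [conj_trivial]
  ring

/-- One half of Weyl's perturbation inequality. -/
theorem eigenvalue_le_add_of_inner_le (b c : OrthonormalBasis (Fin n) ℝ E) {T S : E →ₗ[ℝ] E}
    {l m : Fin n → ℝ} (hT : ∀ i, T (b i) = l i • b i) (hS : ∀ i, S (c i) = m i • c i)
    (hl : Antitone l) (hm : Antitone m) {B : ℝ}
    (hB : ∀ x, inner ℝ (T x) x ≤ inner ℝ (S x) x + B * ‖x‖ ^ 2) (i : Fin n) :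
    l i ≤ m i + B := by
  have : FiniteDimensional ℝ E := b.toBasis.finiteDimensional_of_finite
  -- The kernel of `f` is the intersection of the span of `b j`, `j ≤ i`, with the span of `c j`, `j
  -- ≥ i`. It is cut out by only `n - 1` functionals, hence contains a nonzero vector.
  let f : E →ₗ[ℝ] ({j : Fin n // j ≠ i} → ℝ) :=
    LinearMap.pi fun j => if i < j.1 then (innerₗ E (b j.1)) else (innerₗ E (c j.1))
  have hdim : finrank ℝ ({j : Fin n // j ≠ i} → ℝ) < finrank ℝ E := by
    rw [finrank_eq_card_basis b.toBasis, finrank_fintype_fun_eq_card]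
    exact Fintype.card_subtype_lt (x := i) (by simp)
  obtain ⟨x, hx, hx0⟩ := (Submodule.ne_bot_iff _).1 (LinearMap.ker_ne_bot_of_finrank_lt (f := f) hdim)
  have hfx : ∀ j : {j : Fin n // j ≠ i}, f x j = 0 := fun j => by
    rw [LinearMap.mem_ker.1 hx]; rfl
  have h1 : ∀ j, i < j → inner ℝ (b j) x = 0 := fun j hj => by
    have := hfx ⟨j, hj.ne'⟩
    simpa [f, hj] using this
  have h2 : ∀ j, j < i → inner ℝ (c j) x = 0 := fun j hj => by
    have := hfx ⟨j, hj.ne⟩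
    simpa [f, hj.not_gt] using this
  have h3 : l i * ‖x‖ ^ 2 ≤ inner ℝ (T x) x := by
    rw [inner_apply_self_eq_sum b hT, ← b.sum_sq_inner_right x, Finset.mul_sum]
    refine Finset.sum_le_sum fun j _ => ?_
    rcases lt_or_ge i j with h | h
    · simp [h1 j h]
    · exact mul_le_mul_of_nonneg_right (hl h) (sq_nonneg _)
  have h4 : inner ℝ (S x) x ≤ m i * ‖x‖ ^ 2 := by
    rw [inner_apply_self_eq_sum c hS, ← c.sum_sq_inner_right x, Finset.mul_sum]
    refine Finset.sum_le_sum fun j _ => ?_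
    rcases lt_or_ge j i with h | h
    · simp [h2 j h]
    · exact mul_le_mul_of_nonneg_right (hm h) (sq_nonneg _)
  have hpos : 0 < ‖x‖ ^ 2 := by positivity
  have := hB x
  nlinarith

/-- The Davis–Kahan `sin θ` bound for a single eigenvector. -/
theorem mul_norm_sub_proj_le (c : OrthonormalBasis (Fin n) ℝ E) {T S : E →ₗ[ℝ] E}
    {m : Fin n → ℝ} (hS : ∀ i, S (c i) = m i • c i) {B δ a : ℝ} (hδ : 0 ≤ δ) {x : E} {i : Fin n}
    (hB : ‖T x - S x‖ ≤ B * ‖x‖) (hx : T x = a • x) (hgap : ∀ j, j ≠ i → δ ≤ |a - m j|) :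
    δ ^ 2 * (‖x‖ ^ 2 - inner ℝ (c i) x ^ 2) ≤ (B * ‖x‖) ^ 2 := by
  -- As `T x = a • x`, the residual has coordinate `(a - m j) ⟪c j, x⟫` along `c j`.
  have hres : ‖T x - S x‖ ^ 2 = ∑ j, (a - m j) ^ 2 * inner ℝ (c j) x ^ 2 := by
    rw [← c.sum_sq_inner_right]
    refine Finset.sum_congr rfl fun j _ => ?_
    have hSx : inner ℝ (c j) (S x) = m j * inner ℝ (c j) x := by
      conv_lhs => rw [← c.sum_repr' x]
      simp only [map_sum, map_smul, hS, inner_sum, inner_smul_right]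
      rw [Finset.sum_eq_single j]
      · simp; ring
      · intro k _ hk
        rw [c.inner_eq_zero (Ne.symm hk)]; ring
      · simp
    rw [inner_sub_right, hSx, hx, inner_smul_right]
    ring
  have hsum : ‖x‖ ^ 2 - inner ℝ (c i) x ^ 2 = ∑ j ∈ Finset.univ.erase i, inner ℝ (c j) x ^ 2 := by
    rw [← c.sum_sq_inner_right x, ← Finset.add_sum_erase _ _ (Finset.mem_univ i)]
    ring
  calc δ ^ 2 * (‖x‖ ^ 2 - inner ℝ (c i) x ^ 2)
      = ∑ j ∈ Finset.univ.erase i, δ ^ 2 * inner ℝ (c j) x ^ 2 := by rw [hsum, Finset.mul_sum]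
    _ ≤ ∑ j ∈ Finset.univ.erase i, (a - m j) ^ 2 * inner ℝ (c j) x ^ 2 := by
        refine Finset.sum_le_sum fun j hj => mul_le_mul_of_nonneg_right ?_ (sq_nonneg _)
        rw [← sq_abs (a - m j)]
        exact pow_le_pow_left₀ hδ (hgap j (Finset.ne_of_mem_erase hj)) 2
    _ ≤ ∑ j, (a - m j) ^ 2 * inner ℝ (c j) x ^ 2 :=
        Finset.sum_le_sum_of_subset_of_nonneg (Finset.erase_subset _ _)
          fun _ _ _ => by positivity
    _ = ‖T x - S x‖ ^ 2 := hres.symm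
    _ ≤ (B * ‖x‖) ^ 2 := pow_le_pow_left₀ (norm_nonneg _) hB 2

/-- An eigenvector for a simple eigenvalue is a multiple of the corresponding basis vector. -/
theorem eq_inner_smul_of_simple (c : OrthonormalBasis (Fin n) ℝ E) {S : E →ₗ[ℝ] E}
    (hSs : S.IsSymmetric) {m : Fin n → ℝ} (hS : ∀ i, S (c i) = m i • c i) {y : E} {i : Fin n}
    (hy : S y = m i • y) (hsimple : ∀ j, j ≠ i → m j ≠ m i) :
    y = inner ℝ (c i) y • c i := by
  conv_lhs => rw [← c.sum_repr' y]
  refine Finset.sum_eq_single i (fun j _ hj => ?_) (by simp)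
  have h := hSs (c j) y
  rw [hS, hy, inner_smul_left, inner_smul_right] at h
  have h' : (m j - m i) * inner ℝ (c j) y = 0 := by
    simp only [conj_trivial] at h
    linarith
  rcases mul_eq_zero.1 h' with h' | h'
  · exact absurd (sub_eq_zero.1 h') (hsimple j hj)
  · rw [h', zero_smul]

/-- A symmetric operator whose quadratic form is bounded by `B` has norm at most `B`. -/
theorem norm_apply_le_of_abs_inner_le {T : E →ₗ[ℝ] E} (hT : T.IsSymmetric) {B : ℝ}
    (hB : ∀ x, |inner ℝ (T x) x| ≤ B * ‖x‖ ^ 2) (x : E) : ‖T x‖ ≤ B * ‖x‖ := by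
  rcases eq_or_ne (T x) 0 with h0 | h0
  · rcases eq_or_ne x 0 with rfl | hx
    · simp
    · have := (abs_nonneg _).trans (hB x)
      have hx' : 0 < ‖x‖ ^ 2 := by positivity
      rw [h0, norm_zero]
      exact mul_nonneg (nonneg_of_mul_nonneg_left this hx') (norm_nonneg _)
  have hx : x ≠ 0 := by rintro rfl; simp at h0
  have hx' : 0 < ‖x‖ := norm_pos_iff.2 hx
  have h0' : 0 < ‖T x‖ := norm_pos_iff.2 h0
  -- With `T x` rescaled to the length of `x`, polarisation at `x ± y` and the parallelogram law
  -- turn the form bound into the norm bound.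
  set y : E := (‖x‖ / ‖T x‖) • T x with hy
  have hny : ‖y‖ = ‖x‖ := by
    rw [hy, norm_smul, Real.norm_of_nonneg (by positivity)]
    field_simp
  have hTy : inner ℝ (T x) y = ‖x‖ * ‖T x‖ := by
    rw [hy, inner_smul_right, real_inner_self_eq_norm_sq]
    field_simp
  have hpol : inner ℝ (T (x + y)) (x + y) - inner ℝ (T (x - y)) (x - y) =
      4 * inner ℝ (T x) y := by
    simp only [map_add, map_sub, inner_add_left, inner_add_right, inner_sub_left, inner_sub_right]
    have : inner ℝ (T y) x = inner ℝ (T x) y := by rw [hT, real_inner_comm]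
    rw [this]; ring
  have h1 := (abs_le.1 (hB (x + y))).2
  have h2 := (abs_le.1 (hB (x - y))).1
  have hpar := parallelogram_law_with_norm ℝ x y
  rw [hny] at hpar
  have key : 4 * (‖x‖ * ‖T x‖) ≤ 4 * (‖x‖ * (B * ‖x‖)) := by
    rw [← hTy, ← hpol]
    have : B * ‖x + y‖ ^ 2 + B * ‖x - y‖ ^ 2 = 4 * (‖x‖ * (B * ‖x‖)) := by
      linear_combination B * hpar
    linarith
  exact le_of_mul_le_mul_left (le_of_mul_le_mul_left key (by norm_num)) hx'

end Perturbation

end SparseODN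

namespace SparseODN

open Matrix

/-! ### Rank one updates, traces and resolvents of positive definite matrices. -/

section Sparsification

set_option linter.unusedSectionVars false

variable {κ ι : Type*} [Fintype κ] [DecidableEq κ]

theorem posDef_iff_real {R : Matrix κ κ ℝ} :
    R.PosDef ↔ R.IsSymm ∧ ∀ x, x ≠ 0 → 0 < x ⬝ᵥ R *ᵥ x := by
  rw [posDef_iff_dotProduct_mulVec]
  simp only [star_trivial, IsHermitian, conjTranspose_eq_transpose_of_trivial, IsSymm]

theorem dotProduct_mulVec_comm {R : Matrix κ κ ℝ} (hR : R.IsSymm) (x y : κ → ℝ) :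
    x ⬝ᵥ R *ᵥ y = R *ᵥ x ⬝ᵥ y := by
  rw [dotProduct_mulVec, ← mulVec_transpose, hR.eq]

theorem PosDef.isSymm {R : Matrix κ κ ℝ} (hR : R.PosDef) : R.IsSymm := (posDef_iff_real.1 hR).1

theorem dotProduct_mulVec_nonneg {R : Matrix κ κ ℝ} (hR : R.PosDef) (x : κ → ℝ) :
    0 ≤ x ⬝ᵥ R *ᵥ x := by
  simpa using hR.posSemidef.dotProduct_mulVec_nonneg x

theorem mul_inv_of_posDef {R : Matrix κ κ ℝ} (hR : R.PosDef) : R * R⁻¹ = 1 :=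
  mul_nonsing_inv _ ((isUnit_iff_isUnit_det _).1 hR.isUnit)

theorem inv_mul_of_posDef {R : Matrix κ κ ℝ} (hR : R.PosDef) : R⁻¹ * R = 1 :=
  nonsing_inv_mul _ ((isUnit_iff_isUnit_det _).1 hR.isUnit)

/-- Cauchy–Schwarz for the dual pair of forms `R⁻¹` and `R`: the form of `R` at `x - t R⁻¹v` is a
nonnegative quadratic in `t`, so its discriminant is nonpositive. -/
theorem sq_dotProduct_le {R : Matrix κ κ ℝ} (hR : R.PosDef) (v x : κ → ℝ) :
    (v ⬝ᵥ x) ^ 2 ≤ (v ⬝ᵥ R⁻¹ *ᵥ v) * (x ⬝ᵥ R *ᵥ x) := by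
  have hs : R *ᵥ (R⁻¹ *ᵥ v) = v := by rw [mulVec_mulVec, mul_inv_of_posDef hR, one_mulVec]
  have h : ∀ t : ℝ, 0 ≤ (v ⬝ᵥ R⁻¹ *ᵥ v) * (t * t) + (-2 * (v ⬝ᵥ x)) * t + x ⬝ᵥ R *ᵥ x := by
    intro t
    have := dotProduct_mulVec_nonneg hR (x - t • R⁻¹ *ᵥ v)
    have e1 : (R⁻¹ *ᵥ v) ⬝ᵥ R *ᵥ x = v ⬝ᵥ x := by rw [dotProduct_mulVec_comm (PosDef.isSymm hR), hs]
    simp only [mulVec_sub, mulVec_smul, hs, dotProduct_sub, sub_dotProduct, dotProduct_smul,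
      smul_dotProduct, smul_eq_mul, e1] at this
    rw [dotProduct_comm x v, dotProduct_comm (R⁻¹ *ᵥ v) v] at this
    linarith
  have := discrim_le_zero h
  rw [discrim] at this
  nlinarith

theorem vecMulVec_self_mulVec (v x : κ → ℝ) : vecMulVec v v *ᵥ x = (v ⬝ᵥ x) • v := by
  rw [vecMulVec_mulVec]
  ext i
  simp [mul_comm]

theorem isSymm_vecMulVec_self (v : κ → ℝ) : (vecMulVec v v).IsSymm := transpose_vecMulVec v v

theorem posDef_add_smul_vecMulVec {R : Matrix κ κ ℝ} (hR : R.PosDef) {v : κ → ℝ} {s : ℝ}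
    (hs : 0 < 1 + s * (v ⬝ᵥ R⁻¹ *ᵥ v)) : (R + s • vecMulVec v v).PosDef := by
  refine posDef_iff_real.2 ⟨(PosDef.isSymm hR).add ((isSymm_vecMulVec_self v).smul s), fun x hx => ?_⟩
  have hx' := (posDef_iff_real.1 hR).2 x hx
  have hcs := sq_dotProduct_le hR v x
  have : x ⬝ᵥ (R + s • vecMulVec v v) *ᵥ x = x ⬝ᵥ R *ᵥ x + s * (v ⬝ᵥ x) ^ 2 := by
    rw [add_mulVec, smul_mulVec, vecMulVec_self_mulVec, dotProduct_add, dotProduct_smul,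
      dotProduct_smul, dotProduct_comm x v]
    simp only [smul_eq_mul]; ring
  rw [this]
  rcases le_or_gt 0 s with h | h
  · positivity
  · nlinarith [mul_pos hs hx', mul_le_mul_of_nonpos_left hcs h.le]

/-- The Sherman–Morrison formula. -/
theorem inv_add_smul_vecMulVec {R : Matrix κ κ ℝ} (hR : R.PosDef) {v : κ → ℝ} {s : ℝ}
    (hs : 1 + s * (v ⬝ᵥ R⁻¹ *ᵥ v) ≠ 0) :
    (R + s • vecMulVec v v)⁻¹ =
      R⁻¹ - (s / (1 + s * (v ⬝ᵥ R⁻¹ *ᵥ v))) • vecMulVec (R⁻¹ *ᵥ v) (R⁻¹ *ᵥ v) := by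
  apply inv_eq_right_inv
  set y := R⁻¹ *ᵥ v with hy
  have e1 : R * vecMulVec y y = vecMulVec v y := by
    rw [mul_vecMulVec, hy, mulVec_mulVec, mul_inv_of_posDef hR, one_mulVec]
  have e2 : vecMulVec v v * R⁻¹ = vecMulVec v y := by
    rw [vecMulVec_mul, hy, ← mulVec_transpose, (PosDef.isSymm hR.inv).eq]
  have e3 : vecMulVec v v * vecMulVec y y = (v ⬝ᵥ y) • vecMulVec v y := by
    rw [vecMulVec_mul_vecMulVec, vecMulVec_smul]
  rw [add_mul, mul_sub, mul_sub, mul_inv_of_posDef hR, Matrix.smul_mul, Matrix.mul_smul,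
    Matrix.mul_smul, Matrix.smul_mul, e1, e2, e3, smul_smul, smul_smul]
  have : s - s / (1 + s * (v ⬝ᵥ y)) - s / (1 + s * (v ⬝ᵥ y)) * s * (v ⬝ᵥ y) = 0 := by
    field_simp; ring
  have h2 : (s - s / (1 + s * (v ⬝ᵥ y)) - s / (1 + s * (v ⬝ᵥ y)) * s * (v ⬝ᵥ y)) •
    vecMulVec v y = 0 := by rw [this, zero_smul]
  rw [sub_smul, sub_smul] at h2
  rw [sub_add, sub_eq_self, ← neg_eq_zero, ← h2]
  abel

theorem trace_mul_vecMulVec (P : Matrix κ κ ℝ) (y : κ → ℝ) :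
    (P * vecMulVec y y).trace = y ⬝ᵥ P *ᵥ y := by
  rw [mul_vecMulVec, trace_vecMulVec, dotProduct_comm]

theorem trace_mul_inv_add_smul_vecMulVec (P : Matrix κ κ ℝ) {R : Matrix κ κ ℝ} (hR : R.PosDef)
    {v : κ → ℝ} {s : ℝ} (hs : 1 + s * (v ⬝ᵥ R⁻¹ *ᵥ v) ≠ 0) :
    (P * (R + s • vecMulVec v v)⁻¹).trace = (P * R⁻¹).trace -
      s / (1 + s * (v ⬝ᵥ R⁻¹ *ᵥ v)) * ((R⁻¹ *ᵥ v) ⬝ᵥ P *ᵥ (R⁻¹ *ᵥ v)) := by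
  rw [inv_add_smul_vecMulVec hR hs, mul_sub, trace_sub, Matrix.mul_smul, trace_smul,
    trace_mul_vecMulVec, smul_eq_mul]

variable [Fintype ι]

/-- The Gram-type matrix `∑ i, v i (v i)ᵀ`. -/
def sumOuter (v : ι → κ → ℝ) : Matrix κ κ ℝ := ∑ i, vecMulVec (v i) (v i)

theorem trace_sumOuter_mul (v : ι → κ → ℝ) (K : Matrix κ κ ℝ) :
    (sumOuter v * K).trace = ∑ i, v i ⬝ᵥ K *ᵥ v i := by
  rw [trace_mul_comm, sumOuter, Finset.mul_sum, trace_sum]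
  simp only [trace_mul_vecMulVec]

theorem isSymm_sumOuter (v : ι → κ → ℝ) : (sumOuter v).IsSymm := by
  rw [IsSymm, sumOuter, transpose_sum]
  simp only [transpose_vecMulVec]

theorem dotProduct_sumOuter_mulVec (v : ι → κ → ℝ) (x : κ → ℝ) :
    x ⬝ᵥ sumOuter v *ᵥ x = ∑ i, (v i ⬝ᵥ x) ^ 2 := by
  rw [sumOuter, sum_mulVec, dotProduct_sum]
  refine Finset.sum_congr rfl fun i _ => ?_
  rw [vecMulVec_self_mulVec, dotProduct_smul, dotProduct_comm x, smul_eq_mul, sq]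

theorem trace_sumOuter_mul_nonneg (v : ι → κ → ℝ) {K : Matrix κ κ ℝ} (hK : K.PosSemidef) :
    0 ≤ (sumOuter v * K).trace := by
  rw [trace_sumOuter_mul]
  exact Finset.sum_nonneg fun i _ => by simpa using hK.dotProduct_mulVec_nonneg (v i)

/-- `∑ i, (X v i)ᵀ P (X v i) = tr (P X P X)` -/
theorem sum_dotProduct_mulVec_mulVec (v : ι → κ → ℝ) {X : Matrix κ κ ℝ} (hX : X.IsSymm) :
    ∑ i, (X *ᵥ v i) ⬝ᵥ sumOuter v *ᵥ (X *ᵥ v i) =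
      (sumOuter v * X * sumOuter v * X).trace := by
  rw [mul_assoc, mul_assoc, trace_sumOuter_mul]
  refine Finset.sum_congr rfl fun i _ => ?_
  rw [← dotProduct_mulVec_comm hX, mulVec_mulVec, mulVec_mulVec, mul_assoc]

theorem dotProduct_sumOuter_mulVec_le (v : ι → κ → ℝ) {R : Matrix κ κ ℝ} (hR : R.PosDef)
    (x : κ → ℝ) :
    x ⬝ᵥ sumOuter v *ᵥ x ≤ (sumOuter v * R⁻¹).trace * (x ⬝ᵥ R *ᵥ x) := by
  rw [dotProduct_sumOuter_mulVec, trace_sumOuter_mul, Finset.sum_mul]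
  exact Finset.sum_le_sum fun i _ => sq_dotProduct_le hR _ _

/-- The trace dominates the largest eigenvalue of `sumOuter v` relative to `R`. A small potential
therefore leaves room to advance the lower barrier. -/
theorem posDef_sub_smul_sumOuter (v : ι → κ → ℝ) {R : Matrix κ κ ℝ} (hR : R.PosDef) {δ : ℝ}
    (hδ : 0 ≤ δ) (h : δ * (sumOuter v * R⁻¹).trace < 1) : (R - δ • sumOuter v).PosDef := by
  refine posDef_iff_real.2
    ⟨(PosDef.isSymm hR).sub ((isSymm_sumOuter v).smul δ), fun x hx => ?_⟩
  have hx' := (posDef_iff_real.1 hR).2 x hx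
  have h1 := dotProduct_sumOuter_mulVec_le v hR x
  rw [sub_mulVec, smul_mulVec, dotProduct_sub, dotProduct_smul, smul_eq_mul]
  nlinarith [mul_le_mul_of_nonneg_left h1 hδ]

/-- The resolvent identity. -/
theorem inv_sub_inv_of_eq_add {R R' K : Matrix κ κ ℝ} (hR : R.PosDef) (hR' : R'.PosDef)
    (h : R' = R + K) : R⁻¹ - R'⁻¹ = R⁻¹ * K * R'⁻¹ := by
  have : K = R' - R := by rw [h]; abel
  rw [this, mul_sub, sub_mul, mul_assoc, mul_inv_of_posDef hR', inv_mul_of_posDef hR, mul_one,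
    one_mul]

theorem posSemidef_conj {X Y P : Matrix κ κ ℝ} (hX : X.IsSymm) (hP : P.IsSymm) (hY : Y.PosDef) :
    (X * P * Y * P * X).PosSemidef := by
  have := hY.posSemidef.mul_mul_conjTranspose_same (X * P)
  rwa [conjTranspose_eq_transpose_of_trivial, transpose_mul, hX.eq, hP.eq, ← mul_assoc] at this

/-- A trace form of the Cauchy–Schwarz inequality. -/
theorem sq_trace_le (v : ι → κ → ℝ) {X Y : Matrix κ κ ℝ} (hX : X.IsSymm) (hY : Y.PosDef) :
    (sumOuter v * X * sumOuter v * Y).trace ^ 2 ≤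
      (sumOuter v * Y).trace * (sumOuter v * (X * sumOuter v * Y * sumOuter v * X)).trace := by
  set P := sumOuter v with hP
  have hPs : P.IsSymm := isSymm_sumOuter v
  -- This quadratic is `tr(P (1 - tXP) Y (1 - tXP)ᵀ)`; the claim is that its discriminant is
  -- nonpositive.
  have h : ∀ t : ℝ, 0 ≤ (P * (X * P * Y * P * X)).trace * (t * t) +
      (-2 * (P * X * P * Y).trace) * t + (P * Y).trace := by
    intro t
    have h0 := trace_sumOuter_mul_nonneg v
      (hY.posSemidef.mul_mul_conjTranspose_same (1 - t • (X * P)))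
    rw [conjTranspose_eq_transpose_of_trivial, transpose_sub, transpose_smul, transpose_mul, hX.eq,
      hPs.eq, transpose_one, ← hP] at h0
    have e : P * ((1 - t • (X * P)) * Y * (1 - t • (P * X))) =
        P * Y - t • (P * X * P * Y) - t • (P * Y * P * X) + (t * t) • (P * (X * P * Y * P * X)) := by
      simp only [sub_mul, mul_sub, one_mul, mul_one, Matrix.smul_mul, Matrix.mul_smul, smul_smul,
        mul_assoc]
      abel
    have e2 : (P * Y * P * X).trace = (P * X * P * Y).trace := by
      rw [mul_assoc (P * Y), trace_mul_comm, ← mul_assoc]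
    rw [e, trace_add, trace_sub, trace_sub, trace_smul, trace_smul, trace_smul, e2] at h0
    simp only [smul_eq_mul] at h0
    linarith
  have := discrim_le_zero h
  rw [discrim] at this
  nlinarith

end Sparsification

end SparseODN

namespace SparseODN

open Matrix

/-! ### The barrier argument of Batson, Spielman and Srivastava. -/

section Barriers

variable {κ ι : Type*} [Fintype κ] [DecidableEq κ] [Fintype ι]

/-- Here `R₀` and `R` are the upper slack before and after the barrier moves. The move lowers the
potential by `Δ`; by Sherman–Morrison, subtracting `s w wᵀ` with this `s` raises it by exactly `Δ`.
-/
theorem upper_potential_le (v : ι → κ → ℝ) {R₀ R : Matrix κ κ ℝ} (hR : R.PosDef) {w : κ → ℝ} {s : ℝ}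
    (hs : 0 < s) (hΔ : 0 < (sumOuter v * R₀⁻¹).trace - (sumOuter v * R⁻¹).trace)
    (ha : 0 < (R⁻¹ *ᵥ w) ⬝ᵥ sumOuter v *ᵥ (R⁻¹ *ᵥ w))
    (hsw : s * ((R⁻¹ *ᵥ w) ⬝ᵥ sumOuter v *ᵥ (R⁻¹ *ᵥ w) /
      ((sumOuter v * R₀⁻¹).trace - (sumOuter v * R⁻¹).trace) + w ⬝ᵥ R⁻¹ *ᵥ w) = 1) :
    (R - s • vecMulVec w w).PosDef ∧
      (sumOuter v * (R - s • vecMulVec w w)⁻¹).trace = (sumOuter v * R₀⁻¹).trace := by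
  set a := (R⁻¹ *ᵥ w) ⬝ᵥ sumOuter v *ᵥ (R⁻¹ *ᵥ w)
  set q := w ⬝ᵥ R⁻¹ *ᵥ w with hq
  set Δ := (sumOuter v * R₀⁻¹).trace - (sumOuter v * R⁻¹).trace with hΔd
  have h1 : 1 + -s * q = s * a / Δ := by
    rw [← hsw]; ring
  have hpos : 0 < 1 + -s * q := by rw [h1]; positivity
  have e : R - s • vecMulVec w w = R + (-s) • vecMulVec w w := by
    rw [neg_smul, sub_eq_add_neg]
  rw [e]
  refine ⟨posDef_add_smul_vecMulVec hR hpos, ?_⟩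
  rw [trace_mul_inv_add_smul_vecMulVec _ hR hpos.ne', ← hq, h1]
  have : -s / (s * a / Δ) * a = -Δ := by field_simp
  rw [this, hΔd]; ring

/-- Dual to `upper_potential_le`: advancing the lower barrier raises the potential by `Δ`, and a
large enough `s` makes the added term win this back. -/
theorem lower_potential_le (v : ι → κ → ℝ) {R₀ R : Matrix κ κ ℝ} (hR : R.PosDef) {w : κ → ℝ} {s : ℝ}
    (hs : 0 < s) (hΔ : 0 < (sumOuter v * R⁻¹).trace - (sumOuter v * R₀⁻¹).trace)
    (hsw : 1 ≤ s * ((R⁻¹ *ᵥ w) ⬝ᵥ sumOuter v *ᵥ (R⁻¹ *ᵥ w) /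
      ((sumOuter v * R⁻¹).trace - (sumOuter v * R₀⁻¹).trace) - w ⬝ᵥ R⁻¹ *ᵥ w)) :
    (R + s • vecMulVec w w).PosDef ∧
      (sumOuter v * (R + s • vecMulVec w w)⁻¹).trace ≤ (sumOuter v * R₀⁻¹).trace := by
  have hq0 := dotProduct_mulVec_nonneg hR.inv w
  set a := (R⁻¹ *ᵥ w) ⬝ᵥ sumOuter v *ᵥ (R⁻¹ *ᵥ w) with hadef
  set q := w ⬝ᵥ R⁻¹ *ᵥ w with hq
  set Δ := (sumOuter v * R⁻¹).trace - (sumOuter v * R₀⁻¹).trace with hΔd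
  have hpos : 0 < 1 + s * q := by positivity
  refine ⟨posDef_add_smul_vecMulVec hR hpos, ?_⟩
  rw [trace_mul_inv_add_smul_vecMulVec _ hR hpos.ne', ← hq, ← hadef]
  have h1 : Δ * (1 + s * q) ≤ s * a := by
    have h2 : 1 + s * q ≤ s * a / Δ := by
      calc 1 + s * q ≤ s * (a / Δ - q) + s * q := by gcongr
        _ = s * a / Δ := by ring
    rwa [le_div_iff₀ hΔ, mul_comm] at h2
  have h2 : Δ ≤ s / (1 + s * q) * a := by
    rw [div_mul_eq_mul_div, le_div_iff₀ hpos]; exact h1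
  linarith

theorem trace_sumOuter_mul_inv_sq_pos (v : ι → κ → ℝ) (hP : (sumOuter v).PosDef) [Nonempty κ]
    {R : Matrix κ κ ℝ} (hR : R.PosDef) :
    0 < (sumOuter v * R⁻¹ * sumOuter v * R⁻¹).trace := by
  have hX := PosDef.isSymm hR.inv
  rw [← sum_dotProduct_mulVec_mulVec v hX]
  have hinj : ∀ x : κ → ℝ, R⁻¹ *ᵥ x = 0 → x = 0 := fun x hx => by
    rw [← one_mulVec x, ← mul_inv_of_posDef hR, ← mulVec_mulVec, hx, mulVec_zero]
  obtain ⟨i, hi⟩ : ∃ i, v i ≠ 0 := by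
    by_contra! h
    have h0 : sumOuter v = 0 := by simp [sumOuter, h]
    have := (posDef_iff_real.1 hP).2 1 one_ne_zero
    simp [h0] at this
  refine Finset.sum_pos' (fun j _ => dotProduct_mulVec_nonneg hP _) ⟨i, Finset.mem_univ i, ?_⟩
  exact (posDef_iff_real.1 hP).2 _ fun h => hi (hinj _ h)

/-- By the resolvent identity the potential drops by `δ tr(P R₀⁻¹ P R⁻¹) ≥ δ tr(P R⁻¹ P R⁻¹)`, so
the quotients sum to at most `1 / δ`; the remaining terms sum to the new potential, which is below
the old one. -/
theorem upper_sum_le (v : ι → κ → ℝ) (hP : (sumOuter v).PosDef) [Nonempty κ]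
    {R₀ R : Matrix κ κ ℝ} (hR₀ : R₀.PosDef) (hR : R.PosDef) {δ : ℝ} (hδ : 0 < δ)
    (h : R = R₀ + δ • sumOuter v) :
    0 < (sumOuter v * R₀⁻¹).trace - (sumOuter v * R⁻¹).trace ∧
    ∑ i, ((R⁻¹ *ᵥ v i) ⬝ᵥ sumOuter v *ᵥ (R⁻¹ *ᵥ v i) /
      ((sumOuter v * R₀⁻¹).trace - (sumOuter v * R⁻¹).trace) + v i ⬝ᵥ R⁻¹ *ᵥ v i) ≤
      1 / δ + (sumOuter v * R₀⁻¹).trace := by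
  have hX := PosDef.isSymm hR.inv
  have hpos := trace_sumOuter_mul_inv_sq_pos v hP hR
  have hres := inv_sub_inv_of_eq_add hR₀ hR h
  rw [Finset.sum_add_distrib, ← Finset.sum_div, sum_dotProduct_mulVec_mulVec v hX,
    ← trace_sumOuter_mul v R⁻¹]
  set P := sumOuter v with hPd
  have hΔ : (P * R₀⁻¹).trace - (P * R⁻¹).trace = δ * (P * R₀⁻¹ * P * R⁻¹).trace := by
    rw [← trace_sub, ← mul_sub, hres, Matrix.mul_smul, Matrix.smul_mul, Matrix.mul_smul, trace_smul,
      smul_eq_mul]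
    simp only [mul_assoc]
  have hcomp : (P * R⁻¹ * P * R⁻¹).trace ≤ (P * R₀⁻¹ * P * R⁻¹).trace := by
    have h1 : (P * R₀⁻¹ * P * R⁻¹).trace = (P * R⁻¹ * P * R₀⁻¹).trace := by
      rw [mul_assoc (P * R₀⁻¹), trace_mul_comm, ← mul_assoc]
    have h2 : (P * R⁻¹ * P * R₀⁻¹).trace - (P * R⁻¹ * P * R⁻¹).trace =
        δ * (P * (R⁻¹ * P * R₀⁻¹ * P * R⁻¹)).trace := by
      rw [← trace_sub, ← mul_sub, hres, Matrix.mul_smul, Matrix.smul_mul, Matrix.mul_smul,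
        trace_smul, smul_eq_mul]
      simp only [mul_assoc]
    have h3 := trace_sumOuter_mul_nonneg v (posSemidef_conj hX (isSymm_sumOuter v) hR₀.inv)
    rw [h1]
    rw [← hPd] at h3
    nlinarith
  have hΔpos : 0 < (P * R₀⁻¹).trace - (P * R⁻¹).trace := by
    rw [hΔ]; exact mul_pos hδ (hpos.trans_le hcomp)
  refine ⟨hΔpos, add_le_add ?_ (by linarith)⟩
  rw [div_le_div_iff₀ hΔpos hδ, hΔ]
  nlinarith

theorem lower_sum_ge (v : ι → κ → ℝ) (hP : (sumOuter v).PosDef) [Nonempty κ]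
    {R₀ R : Matrix κ κ ℝ} (hR₀ : R₀.PosDef) (hR : R.PosDef) {δ : ℝ} (hδ : 0 < δ)
    (h : R₀ = R + δ • sumOuter v) (hδa : δ * (sumOuter v * R₀⁻¹).trace ≤ 1) :
    0 < (sumOuter v * R⁻¹).trace - (sumOuter v * R₀⁻¹).trace ∧
    1 / δ - (sumOuter v * R₀⁻¹).trace ≤
      ∑ i, ((R⁻¹ *ᵥ v i) ⬝ᵥ sumOuter v *ᵥ (R⁻¹ *ᵥ v i) /
      ((sumOuter v * R⁻¹).trace - (sumOuter v * R₀⁻¹).trace) - v i ⬝ᵥ R⁻¹ *ᵥ v i) := by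
  have hX := PosDef.isSymm hR.inv
  have hpos := trace_sumOuter_mul_inv_sq_pos v hP hR₀
  have hres := inv_sub_inv_of_eq_add hR hR₀ h
  have hcs := sq_trace_le v hX hR₀.inv
  have hc0 := trace_sumOuter_mul_nonneg v (posSemidef_conj hX (isSymm_sumOuter v) hR₀.inv)
  have hc0' := trace_sumOuter_mul_nonneg v
    (posSemidef_conj (PosDef.isSymm hR₀.inv) (isSymm_sumOuter v) hR.inv)
  rw [Finset.sum_sub_distrib, ← Finset.sum_div, sum_dotProduct_mulVec_mulVec v hX,
    ← trace_sumOuter_mul v R⁻¹]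
  set P := sumOuter v with hPd
  have hb : (P * R⁻¹).trace - (P * R₀⁻¹).trace = δ * (P * R⁻¹ * P * R₀⁻¹).trace := by
    rw [← trace_sub, ← mul_sub, hres, Matrix.mul_smul, Matrix.smul_mul, Matrix.mul_smul, trace_smul,
      smul_eq_mul]
    simp only [mul_assoc]
  have hbb : (P * R⁻¹ * P * R₀⁻¹).trace = (P * R₀⁻¹ * P * R⁻¹).trace := by
    rw [mul_assoc (P * R⁻¹), trace_mul_comm, ← mul_assoc]
  have hres' : R⁻¹ - R₀⁻¹ = δ • (R₀⁻¹ * P * R⁻¹) := by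
    have e : R⁻¹ - R₀⁻¹ = (R⁻¹ - R₀⁻¹)ᵀ := by
      rw [transpose_sub, hX.eq, (PosDef.isSymm hR₀.inv).eq]
    rw [e, hres, transpose_mul, transpose_mul, transpose_smul, hX.eq, (PosDef.isSymm hR₀.inv).eq,
      (isSymm_sumOuter v).eq, Matrix.smul_mul, Matrix.mul_smul, mul_assoc]
  have hc : (P * R⁻¹ * P * R⁻¹).trace - (P * R⁻¹ * P * R₀⁻¹).trace =
      δ * (P * (R⁻¹ * P * R₀⁻¹ * P * R⁻¹)).trace := by
    rw [← trace_sub, ← mul_sub, hres', Matrix.mul_smul, trace_smul, smul_eq_mul]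
    simp only [mul_assoc]
  have hbpos : 0 < (P * R⁻¹ * P * R₀⁻¹).trace := by
    have h2 : (P * R₀⁻¹ * P * R⁻¹).trace - (P * R₀⁻¹ * P * R₀⁻¹).trace =
        δ * (P * (R₀⁻¹ * P * R⁻¹ * P * R₀⁻¹)).trace := by
      rw [← trace_sub, ← mul_sub, hres, Matrix.mul_smul, Matrix.smul_mul, Matrix.mul_smul,
        trace_smul, smul_eq_mul]
      simp only [mul_assoc]
    rw [hbb]
    nlinarith
  have hΔpos : 0 < (P * R⁻¹).trace - (P * R₀⁻¹).trace := by rw [hb]; positivity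
  refine ⟨hΔpos, ?_⟩
  set a := (P * R₀⁻¹).trace
  set b := (P * R⁻¹ * P * R₀⁻¹).trace
  set c := (P * (R⁻¹ * P * R₀⁻¹ * P * R⁻¹)).trace
  have hY : (P * R⁻¹).trace = a + δ * b := by linarith
  have ht : (P * R⁻¹ * P * R⁻¹).trace = b + δ * c := by linarith
  -- With `a` the old potential, this reduces to `δ b² ≤ c`, which follows from the trace
  -- Cauchy–Schwarz bound `b² ≤ a c` and `δ a ≤ 1`.
  have key : 1 / δ + δ * b ≤ (b + δ * c) / (δ * b) := by
    rw [le_div_iff₀ (by positivity)]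
    have h1 : δ * b ^ 2 ≤ c := by nlinarith [mul_le_mul_of_nonneg_left hcs hδ.le]
    have h2 : (1 / δ + δ * b) * (δ * b) = b + δ * (δ * b ^ 2) := by field_simp
    rw [h2]
    nlinarith
  rw [hY, ht]
  have e : a + δ * b - a = δ * b := by ring
  rw [e]
  linarith

/-- One step of the Batson–Spielman–Srivastava barrier argument, in the metric given by
`∑ i, v i (v i)ᵀ`. -/
theorem exists_barrier_step (v : ι → κ → ℝ) (hP : (sumOuter v).PosDef) [Nonempty κ]
    {A : Matrix κ κ ℝ} {u l η δ : ℝ} (hη : η < 1) (hδ : 0 < δ) (hδη : 1 / δ + η < 1 - η)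
    (hu : (u • sumOuter v - A).PosDef) (hl : (A - l • sumOuter v).PosDef)
    (hΦu : (sumOuter v * (u • sumOuter v - A)⁻¹).trace ≤ η)
    (hΦl : (sumOuter v * (A - l • sumOuter v)⁻¹).trace ≤ η) :
    ∃ i, ∃ s : ℝ, 0 < s ∧
      ((u + δ) • sumOuter v - (A + s • vecMulVec (v i) (v i))).PosDef ∧
      (A + s • vecMulVec (v i) (v i) - (l + 1) • sumOuter v).PosDef ∧
      (sumOuter v * ((u + δ) • sumOuter v - (A + s • vecMulVec (v i) (v i)))⁻¹).trace ≤ η ∧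
      (sumOuter v * (A + s • vecMulVec (v i) (v i) - (l + 1) • sumOuter v)⁻¹).trace ≤ η := by
  have eU : (u + δ) • sumOuter v - A = (u • sumOuter v - A) + δ • sumOuter v := by
    rw [add_smul]; abel
  have eL : A - (l + 1) • sumOuter v = (A - l • sumOuter v) - (1 : ℝ) • sumOuter v := by
    rw [add_smul]; abel
  have hU : ((u + δ) • sumOuter v - A).PosDef := by
    rw [eU]; exact hu.add (hP.smul hδ)
  have hL : (A - (l + 1) • sumOuter v).PosDef := by
    rw [eL]; exact posDef_sub_smul_sumOuter v hl zero_le_one (by linarith)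
  obtain ⟨hΔu, hsu⟩ := upper_sum_le v hP hu hU hδ eU
  obtain ⟨hΔl, hsl⟩ := lower_sum_ge v hP hl hL one_pos (by rw [eL]; abel) (by linarith)
  -- Averaging: the upper costs sum to at most `1 / δ + η`, the lower gains to at least `1 - η`, so
  -- some index has cost below gain. The weight is the reciprocal of that cost.
  have hlt := lt_of_le_of_lt hsu (lt_of_lt_of_le (by rw [one_div_one]; linarith) hsl)
  obtain ⟨i, -, hi⟩ := Finset.exists_lt_of_sum_lt hlt
  set Y := ((u + δ) • sumOuter v - A)⁻¹ with hYd
  set Z := (A - (l + 1) • sumOuter v)⁻¹ with hZd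
  have hvi : v i ≠ 0 := by
    intro h0
    simp [h0] at hi
  have hYi : Y *ᵥ v i ≠ 0 := fun h0 => hvi (by
    rw [← one_mulVec (v i), ← mul_inv_of_posDef hU, ← mulVec_mulVec, ← hYd, h0, mulVec_zero])
  have ha : 0 < (Y *ᵥ v i) ⬝ᵥ sumOuter v *ᵥ (Y *ᵥ v i) := (posDef_iff_real.1 hP).2 _ hYi
  have hq : 0 ≤ v i ⬝ᵥ Y *ᵥ v i := dotProduct_mulVec_nonneg hU.inv _
  set U := (Y *ᵥ v i) ⬝ᵥ sumOuter v *ᵥ (Y *ᵥ v i) /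
      ((sumOuter v * (u • sumOuter v - A)⁻¹).trace - (sumOuter v * Y).trace) + v i ⬝ᵥ Y *ᵥ v i
    with hUd
  have hU0 : 0 < U := by positivity
  have h1 := upper_potential_le v (R₀ := u • sumOuter v - A) hU (w := v i) (s := U⁻¹)
    (inv_pos.2 hU0) hΔu ha (inv_mul_cancel₀ hU0.ne')
  have h2 := lower_potential_le v (R₀ := A - l • sumOuter v) hL (w := v i) (s := U⁻¹)
    (inv_pos.2 hU0) hΔl (by
      rw [← div_eq_inv_mul, one_le_div hU0]
      exact hi.le)
  have e1 : (u + δ) • sumOuter v - (A + U⁻¹ • vecMulVec (v i) (v i)) =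
      (u + δ) • sumOuter v - A - U⁻¹ • vecMulVec (v i) (v i) := by abel
  have e2 : A + U⁻¹ • vecMulVec (v i) (v i) - (l + 1) • sumOuter v =
      A - (l + 1) • sumOuter v + U⁻¹ • vecMulVec (v i) (v i) := by abel
  refine ⟨i, U⁻¹, inv_pos.2 hU0, ?_, ?_, ?_, ?_⟩
  · rw [e1]; exact h1.1
  · rw [e2]; exact h2.1
  · rw [e1]; exact h1.2.le.trans hΦu
  · rw [e2]; exact h2.2.trans hΦl

/-- The result of `t` steps of the barrier argument. -/
theorem exists_weights_barrier [DecidableEq ι] (v : ι → κ → ℝ) (hP : (sumOuter v).PosDef)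
    [Nonempty κ] {η δ : ℝ} (hη0 : 0 < η) (hη : η < 1) (hδ : 0 < δ) (hδη : 1 / δ + η < 1 - η)
    (t : ℕ) :
    ∃ s : ι → ℝ, (∀ i, 0 ≤ s i) ∧ (Finset.univ.filter fun i => s i ≠ 0).card ≤ t ∧
      ((Fintype.card κ / η + t * δ) • sumOuter v - ∑ i, s i • vecMulVec (v i) (v i)).PosDef ∧
      (∑ i, s i • vecMulVec (v i) (v i) - (-(Fintype.card κ / η) + t) • sumOuter v).PosDef ∧
      (sumOuter v * ((Fintype.card κ / η + t * δ) • sumOuter v -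
        ∑ i, s i • vecMulVec (v i) (v i))⁻¹).trace ≤ η ∧
      (sumOuter v * (∑ i, s i • vecMulVec (v i) (v i) -
        (-(Fintype.card κ / η) + t) • sumOuter v)⁻¹).trace ≤ η := by
  induction t with
  | zero =>
    -- The barriers start at `±d / η`, `d` the dimension, where both potentials of the zero sum
    -- equal `η`.
    have hc : (0 : ℝ) < Fintype.card κ / η := div_pos (by exact_mod_cast Fintype.card_pos) hη0
    have hPc : ((Fintype.card κ / η : ℝ) • sumOuter v).PosDef := hP.smul hc
    have hinv : ((Fintype.card κ / η : ℝ) • sumOuter v)⁻¹ =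
        (Fintype.card κ / η : ℝ)⁻¹ • (sumOuter v)⁻¹ := by
      apply inv_eq_right_inv
      rw [Matrix.smul_mul, Matrix.mul_smul, smul_smul, mul_inv_cancel₀ hc.ne', one_smul,
        mul_inv_of_posDef hP]
    have htr : (sumOuter v * ((Fintype.card κ / η : ℝ) • sumOuter v)⁻¹).trace ≤ η := by
      rw [hinv, Matrix.mul_smul, mul_inv_of_posDef hP, trace_smul, trace_one, smul_eq_mul]
      have : (Fintype.card κ : ℝ) ≠ 0 := by exact_mod_cast Fintype.card_ne_zero
      apply le_of_eq
      field_simp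
    refine ⟨0, fun _ => le_rfl, by simp, ?_, ?_, ?_, ?_⟩ <;> simpa [neg_smul]
  | succ t ih =>
    obtain ⟨s, hs0, hcard, hu, hl, hΦu, hΦl⟩ := ih
    obtain ⟨i, r, hr, hu', hl', hΦu', hΦl'⟩ :=
      exists_barrier_step v hP hη hδ hδη hu hl hΦu hΦl
    have eA : ∑ j, (s + (Pi.single i r : ι → ℝ)) j • vecMulVec (v j) (v j) =
        ∑ j, s j • vecMulVec (v j) (v j) + r • vecMulVec (v i) (v i) := by
      simp only [Pi.add_apply, add_smul, Finset.sum_add_distrib]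
      congr 1
      rw [Finset.sum_eq_single i (fun j _ hj => by simp [hj]) (by simp)]
      simp
    have eu : (Fintype.card κ / η + ((t + 1 : ℕ) : ℝ) * δ) = Fintype.card κ / η + t * δ + δ := by
      push_cast; ring
    have el : (-(Fintype.card κ / η) + ((t + 1 : ℕ) : ℝ)) = -(Fintype.card κ / η) + t + 1 := by
      push_cast; ring
    refine ⟨s + (Pi.single i r : ι → ℝ), fun j => ?_, ?_, ?_⟩
    · rcases eq_or_ne j i with rfl | h
      · simpa using add_nonneg (hs0 j) hr.le
      · simpa [h] using hs0 j
    · refine le_trans (Finset.card_le_card (t := insert i (Finset.univ.filter fun i => s i ≠ 0))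
        fun j hj => ?_) ((Finset.card_insert_le _ _).trans (Nat.succ_le_succ hcard))
      rcases eq_or_ne j i with rfl | h
      · simp
      · simpa [h] using hj
    · rw [eA, eu, el]
      exact ⟨hu', hl', hΦu', hΦl'⟩

/-- Batson–Spielman–Srivastava spectral sparsification: a positive definite sum of `m` rank one
matrices is approximated within a factor `1 ± ε` by a reweighted subsum of `O(d / ε ^ 2)` of its
terms, where `d` is the dimension. -/
theorem exists_sparse_weights [DecidableEq ι] (v : ι → κ → ℝ) (hP : (sumOuter v).PosDef)
    [Nonempty κ] {ε : ℝ} (hε : 0 < ε) (hε1 : ε ≤ 1 / 2) :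
    ∃ s : ι → ℝ, (∀ i, 0 ≤ s i) ∧
      ((Finset.univ.filter fun i => s i ≠ 0).card : ℝ) ≤ 17 * (Fintype.card κ / ε ^ 2) ∧
      ∀ x, |x ⬝ᵥ (∑ i, s i • vecMulVec (v i) (v i)) *ᵥ x - x ⬝ᵥ sumOuter v *ᵥ x| ≤
        ε * (x ⬝ᵥ sumOuter v *ᵥ x) := by
  set d : ℝ := (Fintype.card κ : ℝ) with hd
  have hd1 : 1 ≤ d := by rw [hd]; exact_mod_cast Fintype.card_pos
  obtain ⟨η, hηε⟩ : ∃ η, η = ε / 4 := ⟨_, rfl⟩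
  have hη0 : 0 < η := by linarith
  have hη1 : η ≤ 1 / 8 := by linarith
  -- This choice gives `1 / δ + η = 1 - 2η`, strictly below `1 - η`.
  obtain ⟨δ, hδd⟩ : ∃ δ, δ = 1 / (1 - 3 * η) := ⟨_, rfl⟩
  have hden : 0 < 1 - 3 * η := by linarith
  have hδ : 0 < δ := by rw [hδd]; positivity
  have hδη : 1 / δ + η < 1 - η := by
    rw [hδd, one_div_one_div]; linarith
  have hδ1 : 1 ≤ δ := by rw [hδd, le_div_iff₀ hden]; linarith
  have hδ2 : δ ≤ 1 + 6 * η := by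
    rw [hδd, div_le_iff₀ hden]; nlinarith
  set N := ⌈d / η ^ 2⌉₊ with hN
  have hNl : d / η ^ 2 ≤ N := Nat.le_ceil _
  have hNu : (N : ℝ) ≤ d / η ^ 2 + 1 := (Nat.ceil_lt_add_one (by positivity)).le
  obtain ⟨s, hs0, hcard, hu, hl, -, -⟩ :=
    exists_weights_barrier v hP hη0 (by linarith) hδ hδη N
  have hNpos : (0 : ℝ) < N := lt_of_lt_of_le (by positivity) hNl
  have hdN : d / η ≤ η * N := by
    have : d / η = η * (d / η ^ 2) := by field_simp
    rw [this]; gcongr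
  -- Up to the initial offsets `±d / η`, the final barriers are `N δ` and `N`; scaling by `c` moves
  -- their midpoint to `1`.
  set c : ℝ := 2 / (N * (1 + δ)) with hc
  have hc0 : 0 < c := by positivity
  have hε4 : ε = 4 * η := by linarith
  -- Given `d / η ≤ η N`, both the upper and the lower estimate reduce to this one inequality.
  have hkey : N * δ ≤ N + 2 * (η * N) + 4 * (η * N * δ) := by
    have h1 := mul_le_mul_of_nonneg_left hδ2 hNpos.le
    have h2 := mul_le_mul_of_nonneg_left hδ1 (mul_pos hη0 hNpos).le
    linarith
  have hupper : c * (d / η + N * δ) ≤ 1 + ε := by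
    rw [hc, div_mul_eq_mul_div, div_le_iff₀ (by positivity)]
    rw [hε4]
    linarith [hkey]
  have hlower : 1 - ε ≤ c * (-(d / η) + N) := by
    rw [hc, div_mul_eq_mul_div, le_div_iff₀ (by positivity)]
    rw [hε4]
    linarith [hkey]
  refine ⟨fun i => c * s i, fun i => mul_nonneg hc0.le (hs0 i), ?_, fun x => ?_⟩
  · have hsub : (Finset.univ.filter fun i => c * s i ≠ 0).card ≤ N :=
      le_trans (Finset.card_le_card fun i hi => Finset.mem_filter.2
        ⟨Finset.mem_univ i, right_ne_zero_of_mul (Finset.mem_filter.1 hi).2⟩) hcard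
    have h1 : ((Finset.univ.filter fun i => c * s i ≠ 0).card : ℝ) ≤ N := by exact_mod_cast hsub
    have h2 : d / η ^ 2 = 16 * (d / ε ^ 2) := by rw [hηε]; field_simp; norm_num
    have h3 : 1 ≤ d / ε ^ 2 := by
      rw [le_div_iff₀ (by positivity)]; nlinarith
    linarith
  · have e : ∑ i, (c * s i) • vecMulVec (v i) (v i) = c • ∑ i, s i • vecMulVec (v i) (v i) := by
      rw [Finset.smul_sum]; simp only [smul_smul]
    have h1 := dotProduct_mulVec_nonneg hu x
    have h2 := dotProduct_mulVec_nonneg hl x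
    have h0 := dotProduct_mulVec_nonneg hP x
    rw [sub_mulVec, smul_mulVec, dotProduct_sub, dotProduct_smul, smul_eq_mul] at h1 h2
    rw [e, smul_mulVec, dotProduct_smul, smul_eq_mul, abs_le]
    set p := x ⬝ᵥ sumOuter v *ᵥ x
    set r := x ⬝ᵥ (∑ i, s i • vecMulVec (v i) (v i)) *ᵥ x
    have h3 := mul_le_mul_of_nonneg_right hupper h0
    have h4 := mul_le_mul_of_nonneg_right hlower h0
    have h5 := mul_nonneg hc0.le h1
    have h6 := mul_nonneg hc0.le h2
    constructor <;> linarith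

end Barriers

end SparseODN

namespace SparseODN

open Matrix Module

/-! ### Ordered eigenvalues, quadratic forms and the spectral radius. -/

section Spectrum

variable {n : ℕ}

theorem exists_eigenbasis (M : Matrix (Fin n) (Fin n) ℝ) (hM : M.IsSymm) :
    ∃ b : OrthonormalBasis (Fin n) ℝ (EuclideanSpace ℝ (Fin n)),
      ∀ i, toEuclideanLin M (b i) = eigval M hM i • b i := by
  have hT := isSymmetric_toEuclideanLin_iff.mpr (isHermitian_of_isSymm hM)
  refine ⟨(hT.eigenvectorBasis finrank_euclideanSpace).reindex
    (finCongr (Fintype.card_fin n)), fun i => ?_⟩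
  rw [OrthonormalBasis.reindex_apply]
  exact hT.apply_eigenvectorBasis finrank_euclideanSpace _

theorem eigval_antitone (M : Matrix (Fin n) (Fin n) ℝ) (hM : M.IsSymm) :
    Antitone (eigval M hM) := fun _ _ h =>
  (isHermitian_of_isSymm hM).eigenvalues₀_antitone h

/-- Finiteness of the spectrum ensures that `toReal` in `rho` does not collapse an infinite value to
`0`. -/
theorem spectralRadius_ne_top (L : Matrix (Fin n) (Fin n) ℝ) : spectralRadius ℝ L ≠ ⊤ := by
  obtain ⟨c, hc⟩ := ((Matrix.finite_real_spectrum (A := L)).image fun k => ‖k‖₊).bddAbove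
  refine ne_top_of_le_ne_top (ENNReal.coe_ne_top (r := c)) (iSup₂_le fun k hk => ?_)
  exact ENNReal.coe_le_coe.2 (hc ⟨k, hk, rfl⟩)

theorem rho_nonneg (L : Matrix (Fin n) (Fin n) ℝ) : 0 ≤ rho L := ENNReal.toReal_nonneg

theorem eigval_le_rho (L : Matrix (Fin n) (Fin n) ℝ) (hL : L.IsSymm) (i : Fin n) :
    eigval L hL i ≤ rho L := by
  have hmem : eigval L hL i ∈ spectrum ℝ L := by
    rw [← spectrum_toLpLin 2]
    exact ((isSymmetric_toEuclideanLin_iff.mpr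
      (isHermitian_of_isSymm hL)).hasEigenvalue_eigenvalues finrank_euclideanSpace _).mem_spectrum
  have h : (‖eigval L hL i‖₊ : ENNReal) ≤ spectralRadius ℝ L :=
    le_iSup₂ (f := fun k (_ : k ∈ spectrum ℝ L) => (‖k‖₊ : ENNReal)) _ hmem
  have h2 := ENNReal.toReal_mono (spectralRadius_ne_top L) h
  exact (le_abs_self _).trans (by simpa [rho] using h2)

theorem inner_toEuclideanLin (M : Matrix (Fin n) (Fin n) ℝ) (x : EuclideanSpace ℝ (Fin n)) :
    inner ℝ (toEuclideanLin M x) x = x.ofLp ⬝ᵥ M *ᵥ x.ofLp := by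
  simp [EuclideanSpace.inner_eq_star_dotProduct, toLpLin_apply]

theorem norm_sq_eq_dotProduct (x : EuclideanSpace ℝ (Fin n)) :
    ‖x‖ ^ 2 = x.ofLp ⬝ᵥ x.ofLp := by
  rw [← real_inner_self_eq_norm_sq, EuclideanSpace.inner_eq_star_dotProduct, star_trivial]

theorem dotProduct_mulVec_le_rho (L : Matrix (Fin n) (Fin n) ℝ) (hL : L.IsSymm)
    (x : Fin n → ℝ) : x ⬝ᵥ L *ᵥ x ≤ rho L * (x ⬝ᵥ x) := by
  obtain ⟨b, hb⟩ := exists_eigenbasis L hL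
  have h1 := inner_apply_self_eq_sum b hb (WithLp.toLp 2 x)
  rw [inner_toEuclideanLin] at h1
  have h2 := norm_sq_eq_dotProduct (WithLp.toLp 2 x)
  simp only at h1 h2
  rw [h1, ← h2, ← b.sum_sq_inner_right, Finset.mul_sum]
  exact Finset.sum_le_sum fun i _ =>
    mul_le_mul_of_nonneg_right (eigval_le_rho L hL i) (sq_nonneg _)

end Spectrum

/-! ### Sparsifying the Laplacian through its edge decomposition. -/

section Laplacian

variable {n : ℕ}

theorem offDiag_isSymm {M : Matrix (Fin n) (Fin n) ℝ} (hM : M.IsSymm) (i j : Fin n) :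
    offDiag M i j = offDiag M j i := by
  simp only [offDiag, of_apply, eq_comm (a := i), hM.apply i j]

theorem offDiag_nonneg {M : Matrix (Fin n) (Fin n) ℝ} (hM : IsODN M) (i j : Fin n) :
    0 ≤ offDiag M i j := by
  simp only [offDiag, of_apply]
  split_ifs with h
  · exact le_rfl
  · exact hM i j h

theorem laplacian_apply (M : Matrix (Fin n) (Fin n) ℝ) (i j : Fin n) :
    laplacian M i j = (if i = j then ∑ k, offDiag M i k else 0) - offDiag M i j := by
  rw [laplacian, Matrix.sub_apply, degMatrix, diagonal_apply]
  congr 2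
  rw [← Finset.add_sum_erase _ _ (Finset.mem_univ i)]
  have : offDiag M i i = 0 := by simp [offDiag]
  rw [this, zero_add]
  refine Finset.sum_congr rfl fun k hk => ?_
  simp [offDiag, (Finset.ne_of_mem_erase hk).symm]

theorem laplacian_isSymm {M : Matrix (Fin n) (Fin n) ℝ} (hM : M.IsSymm) :
    (laplacian M).IsSymm := by
  refine IsSymm.ext fun i j => ?_
  rw [laplacian_apply, laplacian_apply, offDiag_isSymm hM i j]
  rcases eq_or_ne i j with rfl | h
  · rfl
  · simp [h, h.symm]

/-- The rank one decomposition of `L_M + r I`, given by the edges and the vertices. -/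
noncomputable def edgeVec (M : Matrix (Fin n) (Fin n) ℝ) (r : ℝ) :
    (Fin n × Fin n) ⊕ Fin n → Fin n → ℝ
  | .inl p => √(offDiag M p.1 p.2 / 2) • (Pi.single p.1 1 - Pi.single p.2 1)
  | .inr k => √r • Pi.single k 1

/-- The weighted sum of the matrices `(e i - e j) (e i - e j)ᵀ`. -/
theorem sum_mul_edge (w : Fin n × Fin n → ℝ) (a b : Fin n) :
    ∑ p, w p * (((Pi.single p.1 1 : Fin n → ℝ) a - (Pi.single p.2 1 : Fin n → ℝ) a) *
      ((Pi.single p.1 1 : Fin n → ℝ) b - (Pi.single p.2 1 : Fin n → ℝ) b)) =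
    (if a = b then ∑ j, (w (a, j) + w (j, a)) else 0) - w (a, b) - w (b, a) := by
  have e : ∀ p : Fin n × Fin n,
      w p * (((Pi.single p.1 1 : Fin n → ℝ) a - (Pi.single p.2 1 : Fin n → ℝ) a) *
      ((Pi.single p.1 1 : Fin n → ℝ) b - (Pi.single p.2 1 : Fin n → ℝ) b)) =
      (if a = p.1 then (if b = p.1 then w p else 0) else 0) +
      (if a = p.2 then (if b = p.2 then w p else 0) else 0) -
      (if a = p.1 then (if b = p.2 then w p else 0) else 0) -
      (if b = p.1 then (if a = p.2 then w p else 0) else 0) := by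
    intro p
    simp only [Pi.single_apply]
    split_ifs <;> ring
  simp only [e, Finset.sum_sub_distrib, Finset.sum_add_distrib, Fintype.sum_prod_type]
  have h1 : ∑ x, ∑ y, (if a = x then (if b = x then w (x, y) else 0) else 0) =
      if a = b then ∑ j, w (a, j) else 0 := by
    rw [Finset.sum_eq_single a (fun x _ hx => by simp [hx.symm]) (by simp)]
    rcases eq_or_ne a b with rfl | h
    · simp
    · simp [h, h.symm]
  have h2 : ∑ x, ∑ y, (if a = y then (if b = y then w (x, y) else 0) else 0) =
      if a = b then ∑ j, w (j, a) else 0 := by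
    simp only [Finset.sum_ite_eq, Finset.mem_univ, if_true]
    rcases eq_or_ne a b with rfl | h
    · simp
    · simp [h, h.symm]
  have h3 : ∀ c d : Fin n, ∑ x, ∑ y, (if c = x then (if d = y then w (x, y) else 0) else 0) =
      w (c, d) := by
    intro c d
    rw [Finset.sum_eq_single c (fun x _ hx => by simp [hx.symm]) (by simp)]
    simp
  rw [h1, h2, h3, h3]
  split_ifs <;> ring

theorem sum_smul_edgeVec_apply {M : Matrix (Fin n) (Fin n) ℝ} (hM : IsODN M) {r : ℝ} (hr : 0 ≤ r)
    (s : (Fin n × Fin n) ⊕ Fin n → ℝ) (a b : Fin n) :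
    (∑ i, s i • vecMulVec (edgeVec M r i) (edgeVec M r i)) a b =
      (if a = b then (∑ j, (s (.inl (a, j)) * (offDiag M a j / 2) +
        s (.inl (j, a)) * (offDiag M j a / 2))) + s (.inr a) * r else 0) -
        s (.inl (a, b)) * (offDiag M a b / 2) - s (.inl (b, a)) * (offDiag M b a / 2) := by
  rw [Matrix.sum_apply, Fintype.sum_sum_type]
  have h1 : ∀ p : Fin n × Fin n,
      (s (.inl p) • vecMulVec (edgeVec M r (.inl p)) (edgeVec M r (.inl p))) a b =
      (s (.inl p) * (offDiag M p.1 p.2 / 2)) *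
      (((Pi.single p.1 1 : Fin n → ℝ) a - (Pi.single p.2 1 : Fin n → ℝ) a) *
      ((Pi.single p.1 1 : Fin n → ℝ) b - (Pi.single p.2 1 : Fin n → ℝ) b)) := by
    intro p
    have hs := Real.mul_self_sqrt (div_nonneg (offDiag_nonneg hM p.1 p.2) zero_le_two)
    simp only [Matrix.smul_apply, vecMulVec_apply, edgeVec, Pi.smul_apply, Pi.sub_apply, smul_eq_mul]
    conv_rhs => rw [← hs]
    ring
  have h2 : ∑ k, (s (.inr k) • vecMulVec (edgeVec M r (.inr k)) (edgeVec M r (.inr k))) a b =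
      if a = b then s (.inr a) * r else 0 := by
    rw [Finset.sum_eq_single a (fun k _ hk => by
      simp [edgeVec, vecMulVec_apply, hk.symm]) (by simp)]
    rcases eq_or_ne a b with rfl | h
    · simp [edgeVec, vecMulVec_apply, Real.mul_self_sqrt hr]
    · simp [edgeVec, vecMulVec_apply, h, h.symm]
  rw [h2, Finset.sum_congr rfl fun p _ => h1 p,
    sum_mul_edge (fun p => s (.inl p) * (offDiag M p.1 p.2 / 2))]
  split_ifs <;> ring

/-- Every edge occurs as two ordered pairs, hence the halved weight in `edgeVec`; the vertex vectors
add `r I`. -/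
theorem sumOuter_edgeVec {M : Matrix (Fin n) (Fin n) ℝ} (hMs : M.IsSymm) (hM : IsODN M) {r : ℝ}
    (hr : 0 ≤ r) : sumOuter (edgeVec M r) = laplacian M + r • (1 : Matrix (Fin n) (Fin n) ℝ) := by
  ext a b
  have h := sum_smul_edgeVec_apply hM hr (fun _ => 1) a b
  simp only [one_smul, one_mul] at h
  rw [sumOuter, h, Matrix.add_apply, laplacian_apply, Matrix.smul_apply, one_apply, offDiag_isSymm hMs b a]
  have e : ∀ j, offDiag M a j / 2 + offDiag M j a / 2 = offDiag M a j := fun j => by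
    rw [offDiag_isSymm hMs j a]; ring
  simp only [e, smul_eq_mul]
  split_ifs <;> ring

theorem posDef_sumOuter_edgeVec (M : Matrix (Fin n) (Fin n) ℝ) {r : ℝ} (hr : 0 < r) :
    (sumOuter (edgeVec M r)).PosDef := by
  refine posDef_iff_real.2 ⟨isSymm_sumOuter _, fun x hx => ?_⟩
  obtain ⟨k, hk⟩ := Function.ne_iff.1 hx
  rw [dotProduct_sumOuter_mulVec]
  refine Finset.sum_pos' (fun _ _ => sq_nonneg _) ⟨.inr k, Finset.mem_univ _, ?_⟩
  have hs := Real.sqrt_pos.2 hr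
  have hk' : x k ≠ 0 := hk
  simp only [edgeVec, smul_dotProduct, single_one_dotProduct, smul_eq_mul]
  positivity

/-- If `ρ(L_M) = 0`, then `M` is diagonal. -/
theorem offDiag_eq_zero_of_rho_eq_zero {M : Matrix (Fin n) (Fin n) ℝ} (hMs : M.IsSymm)
    (hM : IsODN M) (hρ : rho (laplacian M) = 0) {i j : Fin n} (hij : i ≠ j) : M i j = 0 := by
  have h := dotProduct_mulVec_le_rho _ (laplacian_isSymm hMs) (Pi.single i 1)
  rw [hρ, zero_mul, mulVec_single_one, single_one_dotProduct, col_apply, laplacian_apply] at h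
  have h0 : offDiag M i i = 0 := by simp [offDiag]
  simp only [if_true, h0, sub_zero] at h
  have h1 : offDiag M i j ≤ ∑ k, offDiag M i k :=
    Finset.single_le_sum (fun k _ => offDiag_nonneg hM i k) (Finset.mem_univ j)
  have h2 : offDiag M i j = M i j := by simp [offDiag, hij]
  have := hM i j hij
  linarith

/-- The diagonal is allowed to be full. The pairs in `S` are ordered, so each may account for two
entries of the matrix. -/
theorem nnz_le_of_support (M : Matrix (Fin n) (Fin n) ℝ) (S : Finset (Fin n × Fin n))
    (h : ∀ i j, i ≠ j → M i j ≠ 0 → (i, j) ∈ S ∨ (j, i) ∈ S) : nnz M ≤ n + 2 * S.card := by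
  classical
  have hsub : {p : Fin n × Fin n | M p.1 p.2 ≠ 0} ⊆
      ((Finset.univ.image fun i : Fin n => (i, i)) ∪ (S ∪ S.image Prod.swap) :
        Finset (Fin n × Fin n)) := by
    rintro ⟨i, j⟩ hp
    simp only [Finset.coe_union, Finset.coe_image, Set.mem_union, Set.mem_image, Finset.mem_coe]
    rcases eq_or_ne i j with rfl | hij
    · exact Or.inl ⟨i, Finset.mem_univ i, rfl⟩
    · rcases h i j hij hp with h | h
      · exact Or.inr (Or.inl h)
      · exact Or.inr (Or.inr ⟨(j, i), h, rfl⟩)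
  have h1 := Set.ncard_le_ncard hsub (Finset.finite_toSet _)
  rw [Set.ncard_coe_finset] at h1
  refine h1.trans ((Finset.card_union_le _ _).trans (add_le_add ?_ ?_))
  · simpa using Finset.card_image_le (s := (Finset.univ : Finset (Fin n))) (f := fun i => (i, i))
  · have := Finset.card_union_le S (S.image Prod.swap)
    have := Finset.card_image_le (s := S) (f := Prod.swap)
    omega

/-- Every symmetric ODN matrix has a sparse symmetric ODN approximation within `ε ρ(L_M)` in the
spectral norm. -/
theorem exists_sparse_approx (M : Matrix (Fin n) (Fin n) ℝ) (hMs : M.IsSymm) (hM : IsODN M)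
    {ε : ℝ} (hε : 0 < ε) (hε1 : ε ≤ 1) :
    ∃ N : Matrix (Fin n) (Fin n) ℝ, N.IsSymm ∧ IsODN N ∧ (nnz N : ℝ) ≤ 137 * ((n : ℝ) / ε ^ 2) ∧
      ∀ x, |x ⬝ᵥ (M - N) *ᵥ x| ≤ ε * rho (laplacian M) * (x ⬝ᵥ x) := by
  have hn : (n : ℝ) ≤ n / ε ^ 2 := by
    rw [le_div_iff₀ (by positivity)]
    exact mul_le_of_le_one_right (Nat.cast_nonneg n) (pow_le_one₀ hε.le hε1)
  rcases (rho_nonneg (laplacian M)).eq_or_lt with hρ | hρ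
  · refine ⟨M, hMs, hM, ?_, fun x => by simp [← hρ]⟩
    have h := nnz_le_of_support M ∅ fun i j hij h0 =>
      absurd (offDiag_eq_zero_of_rho_eq_zero hMs hM hρ.symm hij) h0
    have h' : (nnz M : ℝ) ≤ n := by exact_mod_cast h
    have := Nat.cast_nonneg (α := ℝ) n
    linarith
  -- The empty matrix has empty spectrum, hence spectral radius `0`.
  have hn0 : Nonempty (Fin n) := by
    by_contra h
    rw [not_nonempty_iff] at h
    simp [rho, spectralRadius] at hρ
  set ρ := rho (laplacian M) with hρd
  set v := edgeVec M ρ with hv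
  have hP := posDef_sumOuter_edgeVec M hρ
  -- Accuracy `ε / 2` compensates for the form of `L_M + ρ I` being bounded by `2ρ` instead of `ρ`.
  obtain ⟨s, hs0, hcard, hs⟩ := exists_sparse_weights v hP (half_pos hε) (by linarith)
  set S := ∑ i, s i • vecMulVec (v i) (v i) with hS
  have hPL := sumOuter_edgeVec hMs hM hρ.le
  have hSs : S.IsSymm := by
    rw [hS, IsSymm, transpose_sum]
    exact Finset.sum_congr rfl fun i _ => (isSymm_vecMulVec_self (v i)).smul (s i)
  have hentry : ∀ a b, a ≠ b → (M + (sumOuter v - S)) a b =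
      s (.inl (a, b)) * (offDiag M a b / 2) + s (.inl (b, a)) * (offDiag M b a / 2) := by
    intro a b hab
    rw [Matrix.add_apply, Matrix.sub_apply, hS, sum_smul_edgeVec_apply hM hρ.le, hPL, Matrix.add_apply,
      laplacian_apply, Matrix.smul_apply, one_apply]
    have h2 : offDiag M a b = M a b := by simp [offDiag, hab]
    simp only [hab, if_false, h2, smul_eq_mul]
    ring
  refine ⟨M + (sumOuter v - S), hMs.add ((isSymm_sumOuter v).sub hSs), fun a b hab => ?_, ?_,
    fun x => ?_⟩
  · rw [hentry a b hab]
    exact add_nonneg (mul_nonneg (hs0 _) (div_nonneg (offDiag_nonneg hM _ _) zero_le_two))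
      (mul_nonneg (hs0 _) (div_nonneg (offDiag_nonneg hM _ _) zero_le_two))
  · have h := nnz_le_of_support (M + (sumOuter v - S))
      (Finset.univ.filter fun p => s (.inl p) ≠ 0) fun a b hab h0 => by
        rw [hentry a b hab] at h0
        by_contra! hc
        simp only [Finset.mem_filter, Finset.mem_univ, true_and, not_not] at hc
        simp [hc.1, hc.2] at h0
    have hle : (Finset.univ.filter fun p => s (.inl p) ≠ 0).card ≤
        (Finset.univ.filter fun i => s i ≠ 0).card :=
      Finset.card_le_card_of_injOn Sum.inl (fun p hp => by simpa using hp)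
        Sum.inl_injective.injOn
    have h1 : (nnz (M + (sumOuter v - S)) : ℝ) ≤
        n + 2 * (Finset.univ.filter fun i => s i ≠ 0).card := by
      have h' := (Nat.cast_le (α := ℝ)).2
        (h.trans (Nat.add_le_add_left (Nat.mul_le_mul_left 2 hle) n))
      rwa [Nat.cast_add, Nat.cast_mul, Nat.cast_ofNat] at h'
    rw [Fintype.card_fin] at hcard
    -- The constant arises as `137 = 1 + 2 · 17 · 4`.
    have h2 : (n : ℝ) / (ε / 2) ^ 2 = 4 * (n / ε ^ 2) := by field_simp; norm_num
    linarith
  · have e : M - (M + (sumOuter v - S)) = S - sumOuter v := by abel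
    rw [e, sub_mulVec, dotProduct_sub]
    refine (hs x).trans ?_
    have h1 := dotProduct_mulVec_le_rho _ (laplacian_isSymm hMs) x
    rw [hPL, add_mulVec, smul_mulVec, one_mulVec, dotProduct_add, dotProduct_smul, smul_eq_mul]
    have := mul_le_mul_of_nonneg_left h1 hε.le
    linarith

end Laplacian

/-! ### Angles, gaps and the final bound. -/

section Conclusion

variable {n : ℕ}

theorem mul_rho_le_errBound (M : Matrix (Fin n) (Fin n) ℝ) {ε : ℝ} (hε : 0 < ε) (i : Fin n) :
    ε * rho (laplacian M) ≤ errBound M ε := by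
  have h1 : minDiag M ≤ maxDiag M :=
    (ciInf_le (Set.finite_range fun i => M i i).bddBelow i).trans
      (le_ciSup (f := fun i => M i i) (Set.finite_range _).bddAbove i)
  have h2 : 1 ≤ √(n : ℝ) := by
    rw [Real.one_le_sqrt]
    exact_mod_cast i.pos
  have h3 := mul_le_mul_of_nonneg_left h2 (mul_nonneg hε.le (rho_nonneg (laplacian M)))
  rw [errBound]
  linarith

/-- Both sides are the squared distance from `x` to the line of `c`; this links the angle to the
Davis–Kahan estimate. -/
theorem sin_lineAngle_sq_mul (x y c : EuclideanSpace ℝ (Fin n)) (hc : ‖c‖ = 1) (hx : x ≠ 0)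
    {t : ℝ} (ht : t ≠ 0) (hy : y = t • c) :
    (Real.sin (lineAngle x y) * ‖x‖) ^ 2 = ‖x‖ ^ 2 - inner ℝ c x ^ 2 := by
  have hx' : 0 < ‖x‖ := norm_pos_iff.2 hx
  have h1 : |inner ℝ x y| / (‖x‖ * ‖y‖) = |inner ℝ c x| / ‖x‖ := by
    rw [hy, inner_smul_right, norm_smul, hc, abs_mul, Real.norm_eq_abs, mul_one,
      real_inner_comm]
    have : |t| ≠ 0 := abs_ne_zero.2 ht
    field_simp
  have h2 : inner ℝ c x ^ 2 ≤ ‖x‖ ^ 2 := by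
    have := abs_real_inner_le_norm c x
    rw [hc, one_mul] at this
    rw [← sq_abs]
    gcongr
  rw [lineAngle, h1, Real.sin_arccos, mul_pow, Real.sq_sqrt]
  · rw [div_pow, sq_abs]
    field_simp
  · rw [div_pow, sq_abs, sub_nonneg, div_le_one (by positivity)]
    exact h2

theorem sin_lineAngle_nonneg (x y : EuclideanSpace ℝ (Fin n)) :
    0 ≤ Real.sin (lineAngle x y) :=
  Real.sin_nonneg_of_nonneg_of_le_pi (Real.arccos_nonneg _) (Real.arccos_le_pi _)

/-- If the gap is at most `B`, the right side is at least `1`. Otherwise the gap exceeds `|l i - m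
i|`, so monotonicity puts the neighbours of `m i` strictly on their own sides of it. Then `m i` is
simple and every other `m j` is at least the gap away from `l i`, as `H` requires. -/
theorem sin_le_div_gap {l m : Fin n → ℝ} (hm : Antitone m) {B σ : ℝ} (hσ0 : 0 ≤ σ) (hσ1 : σ ≤ 1)
    (i : Fin n) (hlm : |l i - m i| ≤ B) (hgap0 : gap l m i ≠ 0)
    (H : ∀ δ, 0 ≤ δ → (∀ j, j ≠ i → δ ≤ |l i - m j|) → (∀ j, j ≠ i → m j ≠ m i) → δ * σ ≤ B) :
    ENNReal.ofReal σ ≤ ENNReal.ofReal B / gap l m i := by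
  have hB : 0 ≤ B := (abs_nonneg _).trans hlm
  rcases le_or_gt (gap l m i) (ENNReal.ofReal B) with h | h
  · calc ENNReal.ofReal σ ≤ 1 := by simpa using hσ1
      _ ≤ ENNReal.ofReal B / gap l m i := by
        rw [ENNReal.le_div_iff_mul_le (Or.inl hgap0)
          (Or.inl (ne_top_of_le_ne_top ENNReal.ofReal_ne_top h)), one_mul]
        exact h
  have hlm' := abs_le.1 hlm
  have hlow : ∀ j, j < i → gap l m i ≤ ENNReal.ofReal |l i - m j| ∧ m i < m j := by
    intro j hj
    have hi : 0 < i.val := lt_of_le_of_lt (Nat.zero_le _) hj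
    set k : Fin n := ⟨i.val - 1, lt_of_le_of_lt (Nat.sub_le _ _) i.isLt⟩ with hk
    have hjk : j ≤ k := Fin.le_def.2 (by simp only [hk]; have := Fin.lt_def.1 hj; omega)
    have hki : k ≤ i := Fin.le_def.2 (by simp only [hk]; omega)
    have hg : gap l m i ≤ ENNReal.ofReal |m k - l i| := by
      rw [gap, if_pos hi]; exact min_le_left _ _
    have hBk : B < |m k - l i| := (ENNReal.ofReal_lt_ofReal_iff_of_nonneg hB).1 (h.trans_le hg)
    have hk1 := hm hki
    have hk2 := hm hjk
    have hpos : l i + B < m k := by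
      rcases lt_abs.1 hBk with h' | h' <;> linarith
    refine ⟨hg.trans (ENNReal.ofReal_le_ofReal ?_), by linarith⟩
    rw [abs_of_pos (by linarith), abs_of_neg (by linarith)]
    linarith
  have hhigh : ∀ j, i < j → gap l m i ≤ ENNReal.ofReal |l i - m j| ∧ m j < m i := by
    intro j hj
    have hi : i.val + 1 < n := lt_of_le_of_lt (Nat.succ_le_of_lt (Fin.lt_def.1 hj)) j.isLt
    set k : Fin n := ⟨i.val + 1, hi⟩ with hk
    have hjk : k ≤ j := Fin.le_def.2 (by simp only [hk]; have := Fin.lt_def.1 hj; omega)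
    have hki : i ≤ k := Fin.le_def.2 (by simp only [hk]; omega)
    have hg : gap l m i ≤ ENNReal.ofReal |l i - m k| := by
      rw [gap, dif_pos hi]; exact min_le_right _ _
    have hBk : B < |l i - m k| := (ENNReal.ofReal_lt_ofReal_iff_of_nonneg hB).1 (h.trans_le hg)
    have hk1 := hm hki
    have hk2 := hm hjk
    have hpos : m k < l i - B := by
      rcases lt_abs.1 hBk with h' | h' <;> linarith
    refine ⟨hg.trans (ENNReal.ofReal_le_ofReal ?_), by linarith⟩
    rw [abs_of_pos (by linarith), abs_of_pos (by linarith)]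
    linarith
  have hne : ∀ j, j ≠ i → m j ≠ m i := fun j hj => by
    rcases lt_or_gt_of_ne hj with hj | hj
    · exact (hlow j hj).2.ne'
    · exact (hhigh j hj).2.ne
  have hall : ∀ j, j ≠ i → gap l m i ≤ ENNReal.ofReal |l i - m j| := fun j hj => by
    rcases lt_or_gt_of_ne hj with hj | hj
    · exact (hlow j hj).1
    · exact (hhigh j hj).1
  -- An infinite gap leaves no index `j ≠ i`, so `H` holds for arbitrarily large `δ` and forces `σ =
  -- 0`.
  rcases eq_or_ne (gap l m i) ⊤ with htop | htop
  · have hσ : σ = 0 := by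
      by_contra hσ
      have hσ' : 0 < σ := lt_of_le_of_ne hσ0 (Ne.symm hσ)
      have := H ((B + 1) / σ) (by positivity) (fun j hj => absurd (hall j hj) (by simp [htop])) hne
      rw [div_mul_cancel₀ _ hσ] at this
      linarith
    simp [hσ]
  · set δ := (gap l m i).toReal with hδ
    have hδ0 : 0 < δ := ENNReal.toReal_pos hgap0 htop
    have hgd : gap l m i = ENNReal.ofReal δ := (ENNReal.ofReal_toReal htop).symm
    rw [hgd, ← ENNReal.ofReal_div_of_pos hδ0]
    refine ENNReal.ofReal_le_ofReal ?_
    rw [le_div_iff₀ hδ0, mul_comm]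
    refine H δ hδ0.le (fun j hj => ?_) hne
    have := hall j hj
    rwa [hgd, ENNReal.ofReal_le_ofReal_iff (abs_nonneg _)] at this

end Conclusion

end SparseODN

/-! ### The main theorem. -/

open SparseODN in
theorem theorem1 :
    ∃ C : ℝ, 0 < C ∧
      ∀ (n : ℕ) (M : Matrix (Fin n) (Fin n) ℝ) (hM : M.IsSymm), SparseODN.IsODN M →
      ∀ ε : ℝ, 0 < ε → ε ≤ 1 / 120 →
      ∃ (Mhat : Matrix (Fin n) (Fin n) ℝ) (hMhat : Mhat.IsSymm),
        SparseODN.IsODN Mhat ∧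
        (SparseODN.nnz Mhat : ℝ) ≤ C * ((n : ℝ) / ε ^ 2) ∧
        (∀ i : Fin n,
          |SparseODN.eigval M hM i - SparseODN.eigval Mhat hMhat i| ≤ SparseODN.errBound M ε) ∧
        (∀ (i : Fin n) (x xhat : EuclideanSpace ℝ (Fin n)),
          Module.End.HasEigenvector (Matrix.toEuclideanLin M) (SparseODN.eigval M hM i) x →
          Module.End.HasEigenvector (Matrix.toEuclideanLin Mhat)
            (SparseODN.eigval Mhat hMhat i) xhat →
          SparseODN.gap (SparseODN.eigval M hM) (SparseODN.eigval Mhat hMhat) i ≠ 0 →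
          ENNReal.ofReal (Real.sin (SparseODN.lineAngle x xhat)) ≤
            ENNReal.ofReal (SparseODN.errBound M ε) /
              SparseODN.gap (SparseODN.eigval M hM) (SparseODN.eigval Mhat hMhat) i) := by
  refine ⟨137, by norm_num, fun n M hMs hM ε hε hε1 => ?_⟩
  obtain ⟨N, hNs, hN, hnnz, hquad⟩ := exists_sparse_approx M hMs hM hε (by linarith)
  obtain ⟨b, hb⟩ := exists_eigenbasis M hMs
  obtain ⟨c, hc⟩ := exists_eigenbasis N hNs
  set T := Matrix.toEuclideanLin M with hT
  set S := Matrix.toEuclideanLin N with hS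
  have hform : ∀ x, |inner ℝ ((T - S) x) x| ≤ ε * rho (laplacian M) * ‖x‖ ^ 2 := fun x => by
    rw [hT, hS, ← map_sub, inner_toEuclideanLin, norm_sq_eq_dotProduct]
    exact hquad x
  have hform1 : ∀ x, inner ℝ (T x) x ≤ inner ℝ (S x) x + ε * rho (laplacian M) * ‖x‖ ^ 2 :=
    fun x => by
      have := (abs_le.1 (hform x)).2
      rw [LinearMap.sub_apply, inner_sub_left] at this
      linarith
  have hform2 : ∀ x, inner ℝ (S x) x ≤ inner ℝ (T x) x + ε * rho (laplacian M) * ‖x‖ ^ 2 :=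
    fun x => by
      have := (abs_le.1 (hform x)).1
      rw [LinearMap.sub_apply, inner_sub_left] at this
      linarith
  have hTs : T.IsSymmetric := Matrix.isSymmetric_toEuclideanLin_iff.mpr (isHermitian_of_isSymm hMs)
  have hSs : S.IsSymmetric := Matrix.isSymmetric_toEuclideanLin_iff.mpr (isHermitian_of_isSymm hNs)
  have hnorm := norm_apply_le_of_abs_inner_le (hTs.sub hSs) hform
  have hM' := eigval_antitone M hMs
  have hN' := eigval_antitone N hNs
  have hweyl : ∀ i, |eigval M hMs i - eigval N hNs i| ≤ errBound M ε := fun i => by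
    have h1 := eigenvalue_le_add_of_inner_le b c hb hc hM' hN' hform1 i
    have h2 := eigenvalue_le_add_of_inner_le c b hc hb hN' hM' hform2 i
    refine le_trans ?_ (mul_rho_le_errBound M hε i)
    rw [abs_le]
    constructor <;> linarith
  refine ⟨N, hNs, hN, hnnz, hweyl, fun i x y hx hy hgap => ?_⟩
  refine sin_le_div_gap hN' (sin_lineAngle_nonneg x y) (Real.sin_le_one _) i (hweyl i) hgap
    fun δ hδ hsep hsimple => ?_
  have hx0 : 0 < ‖x‖ := norm_pos_iff.2 hx.2
  -- Simplicity makes the arbitrary eigenvector `y` span the same line as `c i`, to which the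
  -- Davis–Kahan bound applies.
  have hyc := eq_inner_smul_of_simple c hSs hc hy.apply_eq_smul hsimple
  have ht : inner ℝ (c i) y ≠ 0 := fun h0 => hy.2 (by rw [hyc, h0, zero_smul])
  have hdk := mul_norm_sub_proj_le c hc hδ (hnorm x) hx.apply_eq_smul hsep
  rw [← sin_lineAngle_sq_mul x y (c i) (c.norm_eq_one i) hx.2 ht hyc, ← mul_pow] at hdk
  have hρ0 : 0 ≤ ε * rho (laplacian M) := mul_nonneg hε.le (rho_nonneg _)
  have h1 := (pow_le_pow_iff_left₀
    (mul_nonneg hδ (mul_nonneg (sin_lineAngle_nonneg x y) hx0.le))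
    (mul_nonneg hρ0 hx0.le) two_ne_zero).1 hdk
  rw [← mul_assoc] at h1
  exact (le_of_mul_le_mul_right h1 hx0).trans (mul_rho_le_errBound M hε i)
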